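/- Let $K$ be an algebraically closed field of characteristic zero and let $R=K[s,t,u,v]$ be the total coordinate ring of $\mathbb{P}^1\times\mathbb{P}^1$, bigraded by $\deg s=\deg t=(1,0)$ and $\deg u=\deg v=(0,1)$. For a point $P=A\times B\in\mathbb{P}^1\times\mathbb{P}^1$ let $I_P=\langle h,l\rangle$, where $h$ is a nonzero linear form in $s,t$ vanishing at $A$ and $l$ is a nonzero linear form in $u,v$ vanishing at $B$. For a finite set $X\subset\mathbb{P}^1\times\mathbb{P}^1$ let $I_X=\bigcap_{P\in X}I_P$ and $H_X(i,j)=\dim_K R_{(i,j)}-\dim_K (I_X)_{(i,j)}$. A set $X$ of $r$ distinct points is called generic if $H_X(i,j)=\min\{(i+1)(j+1),r\}$ for all $i,j\ge 0$. Let $X$ be a generic set of $r$ points in $\mathbb{P}^1\times\mathbb{P}^1$, and let $M$ be the graded $K[s,t]$-module $M=\bigoplus_{i\ge 0}(I_X)_{(i,1)}\subset R$. Then $M$ is minimally generated by two bihomogeneous elements, and the bidegrees of the minimal generators are $(k,1),(k,1)$ if $r=2k$, and $(k,1),(k+1,1)$ if $r=2k+1$. That is, there is a minimal (irredundant) system of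 bihomogeneous generators of $M$ consisting of two elements of these bidegrees, and every minimal system of bihomogeneous generators of $M$ consists of two elements of these bidegrees. -/

import Mathlib

open scoped LinearAlgebra.Projectivization

universe u

noncomputable section

namespace BiProj

/-- The total coordinate ring `K[s, t, u, v]` of `ℙ¹ × ℙ¹`: the left variables `inl 0`, `inl 1`
are `s, t` and the right variables `inr 0`, `inr 1` are `u, v`. -/
abbrev CoordRing (K : Type u) [Field K] : Type u := MvPolynomial (Fin 2 ⊕ Fin 2) K

/-- The ring `K[s, t]`. -/
abbrev FirstRing (K : Type u) [Field K] : Type u := MvPolynomial (Fin 2) K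

variable (K : Type u) [Field K]

/-- `K[s, t, u, v]` is an algebra over `K[s, t]` through the inclusion. -/
instance firstRingAlgebra : Algebra (FirstRing K) (CoordRing K) :=
  (MvPolynomial.rename (R := K) (Sum.inl : Fin 2 → Fin 2 ⊕ Fin 2)).toRingHom.toAlgebra

theorem algebraMap_firstRing (p : FirstRing K) :
    algebraMap (FirstRing K) (CoordRing K) p = MvPolynomial.rename Sum.inl p := rfl

theorem firstRing_smul_def (p : FirstRing K) (f : CoordRing K) :
    p • f = MvPolynomial.rename Sum.inl p * f := rfl

instance firstRingScalarTower : IsScalarTower K (FirstRing K) (CoordRing K) :=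
  IsScalarTower.of_algebraMap_eq fun c => by
    rw [algebraMap_firstRing, MvPolynomial.algebraMap_eq, MvPolynomial.algebraMap_eq,
      MvPolynomial.rename_C]

/-- The bidegrees of the variables: `deg s = deg t = (1, 0)`, `deg u = deg v = (0, 1)`. -/
def bidegree : Fin 2 ⊕ Fin 2 → ℕ × ℕ := Sum.elim (fun _ => (1, 0)) (fun _ => (0, 1))

/-- The `K`-vector space `R_{(i,j)}` of forms of bidegree `d = (i, j)`. -/
abbrev forms (d : ℕ × ℕ) : Submodule K (CoordRing K) :=
  MvPolynomial.weightedHomogeneousSubmodule K bidegree d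

variable {K}

/-- The `K`-vector space `I_{(i,j)}` of forms of bidegree `d = (i, j)` in the ideal `I`. -/
def idealForms (I : Ideal (CoordRing K)) (d : ℕ × ℕ) : Submodule K (CoordRing K) :=
  I.restrictScalars K ⊓ forms K d

/-- A nonzero linear form in `s, t` vanishing at the point `[a 0 : a 1]`. -/
def lineFst (a : Fin 2 → K) : CoordRing K :=
  MvPolynomial.C (a 1) * MvPolynomial.X (Sum.inl 0) -
    MvPolynomial.C (a 0) * MvPolynomial.X (Sum.inl 1)

/-- A nonzero linear form in `u, v` vanishing at the point `[b 0 : b 1]`. -/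
def lineSnd (b : Fin 2 → K) : CoordRing K :=
  MvPolynomial.C (b 1) * MvPolynomial.X (Sum.inr 0) -
    MvPolynomial.C (b 0) * MvPolynomial.X (Sum.inr 1)

/-- The ideal `⟨h, l⟩` of a point `P = A × B`, where `h` and `l` are linear forms in `s, t` and in
`u, v` that vanish at `A` and at `B`. It does not depend on the chosen homogeneous coordinates:
see `pointIdeal_mk`. -/
def pointIdeal (P : ℙ K (Fin 2 → K) × ℙ K (Fin 2 → K)) : Ideal (CoordRing K) :=
  Ideal.span {lineFst P.1.rep, lineSnd P.2.rep}

theorem pointIdeal_mk (a b : Fin 2 → K) (ha : a ≠ 0) (hb : b ≠ 0) :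
    pointIdeal (Projectivization.mk K a ha, Projectivization.mk K b hb) =
      Ideal.span {lineFst a, lineSnd b} := by
  obtain ⟨x, hx⟩ := Projectivization.exists_smul_eq_mk_rep K a ha
  obtain ⟨y, hy⟩ := Projectivization.exists_smul_eq_mk_rep K b hb
  have h1 : lineFst (x • a) = MvPolynomial.C (x : K) * lineFst a := by
    simp only [lineFst, Units.smul_def, Pi.smul_apply, smul_eq_mul, MvPolynomial.C_mul]; ring
  have h2 : lineSnd (y • b) = MvPolynomial.C (y : K) * lineSnd b := by
    simp only [lineSnd, Units.smul_def, Pi.smul_apply, smul_eq_mul, MvPolynomial.C_mul]; ring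
  have ux : IsUnit (MvPolynomial.C (x : K) : CoordRing K) := x.isUnit.map MvPolynomial.C
  have uy : IsUnit (MvPolynomial.C (y : K) : CoordRing K) := y.isUnit.map MvPolynomial.C
  rw [pointIdeal, ← hx, ← hy, h1, h2, Ideal.span_insert, Ideal.span_insert,
    Ideal.span_singleton_mul_left_unit ux, Ideal.span_singleton_mul_left_unit uy]

/-- The ideal `I_X` of a finite set `X` of points: the intersection of the ideals of its points
(the unit ideal if `X` is empty). -/
def pointsIdeal (X : Finset (ℙ K (Fin 2 → K) × ℙ K (Fin 2 → K))) : Ideal (CoordRing K) :=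
  ⨅ P ∈ X, pointIdeal P

/-- The bigraded Hilbert function `H_X(i,j) = dim R_{(i,j)} - dim (I_X)_{(i,j)}`. The spaces are
finite-dimensional and the second is contained in the first, so nothing is truncated:
see `finite_forms` and `finrank_idealForms_le`. -/
def hilbertFunction (X : Finset (ℙ K (Fin 2 → K) × ℙ K (Fin 2 → K))) (i j : ℕ) : ℕ :=
  Module.finrank K (forms K (i, j)) - Module.finrank K (idealForms (pointsIdeal X) (i, j))

theorem finite_forms (d : ℕ × ℕ) : Module.Finite K (forms K d) := by
  have hle : forms K d ≤ MvPolynomial.restrictTotalDegree (Fin 2 ⊕ Fin 2) K (d.1 + d.2) := by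
    intro f hf
    rw [MvPolynomial.mem_restrictTotalDegree]
    refine Finset.sup_le fun m hm => ?_
    have h := hf (MvPolynomial.mem_support_iff.mp hm)
    rw [Finsupp.weight_apply, Finsupp.sum_fintype _ _ (by simp)] at h
    rw [Finsupp.sum_fintype _ _ (by simp), ← h]
    simp [bidegree, Fintype.sum_sum_type]
  exact Submodule.finiteDimensional_of_le hle

theorem finrank_idealForms_le (I : Ideal (CoordRing K)) (d : ℕ × ℕ) :
    Module.finrank K (idealForms I d) ≤ Module.finrank K (forms K d) :=
  haveI := finite_forms (K := K) d
  Submodule.finrank_mono inf_le_right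

/-- A finite set `X` of `r` points is generic if `H_X(i,j) = min {(i+1)(j+1), r}` for all
`i, j ≥ 0`. -/
def IsGeneric (X : Finset (ℙ K (Fin 2 → K) × ℙ K (Fin 2 → K))) : Prop :=
  ∀ i j : ℕ, hilbertFunction X i j = min ((i + 1) * (j + 1)) X.card

theorem smul_mem_iSup_idealForms (I : Ideal (CoordRing K)) (p : FirstRing K) {f : CoordRing K}
    (hf : f ∈ ⨆ i : ℕ, idealForms I (i, 1)) : p • f ∈ ⨆ i : ℕ, idealForms I (i, 1) := by
  induction p using MvPolynomial.induction_on generalizing f with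
  | C c =>
    rw [firstRing_smul_def, MvPolynomial.rename_C, ← MvPolynomial.smul_eq_C_mul]
    exact Submodule.smul_mem _ c hf
  | add p q hp hq => rw [add_smul]; exact Submodule.add_mem _ (hp hf) (hq hf)
  | mul_X p n hp =>
    rw [mul_smul]
    refine hp ?_
    induction hf using Submodule.iSup_induction' with
    | mem i g hg =>
      refine Submodule.mem_iSup_of_mem (i + 1) ⟨Ideal.mul_mem_left I _ hg.1, ?_⟩
      have := (MvPolynomial.isWeightedHomogeneous_X K bidegree (Sum.inl n)).mul hg.2
      simpa [firstRing_smul_def, bidegree, add_comm] using this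
    | zero => simp
    | add a b _ _ ha hb => rw [smul_add]; exact Submodule.add_mem _ ha hb

/-- The graded `K[s, t]`-module `⨁_i I_{(i,1)}`, realized as the (internal direct) sum of the
subspaces `I_{(i,1)}` inside `K[s, t, u, v]`. -/
def moduleM (I : Ideal (CoordRing K)) : Submodule (FirstRing K) (CoordRing K) where
  carrier := (⨆ i : ℕ, idealForms I (i, 1) : Submodule K (CoordRing K))
  add_mem' := Submodule.add_mem _
  zero_mem' := Submodule.zero_mem _
  smul_mem' p _ hf := smul_mem_iSup_idealForms I p hf

/-- The sum in the definition of `moduleM` is direct. -/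
theorem iSupIndep_idealForms (I : Ideal (CoordRing K)) :
    iSupIndep fun i : ℕ => idealForms I (i, 1) := by
  have h : iSupIndep (forms K) :=
    (MvPolynomial.weightedGradedAlgebra K bidegree).isInternal.submodule_iSupIndep
  have h2 : iSupIndep fun i : ℕ => forms K (i, 1) :=
    h.comp (f := fun i : ℕ => (i, 1)) fun a b hab => by simpa using hab
  exact h2.mono fun i => inf_le_right

/-- `g` is a minimal family of bihomogeneous generators, of bidegrees `d`, of the
`K[s, t]`-submodule `M`: it generates `M`, and no member lies in the submodule generated by the
others. -/
structure IsMinimalGenerators (M : Submodule (FirstRing K) (CoordRing K)) {ι : Type*}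
    (g : ι → CoordRing K) (d : ι → ℕ × ℕ) : Prop where
  homogeneous : ∀ i, g i ∈ forms K (d i)
  span_eq : Submodule.span (FirstRing K) (Set.range g) = M
  irredundant : ∀ i, g i ∉ Submodule.span (FirstRing K) (g '' {i}ᶜ)

/-- `M` has exactly `n` minimal generators, and their bidegrees are `d 0, …, d (n - 1)`: there is a
minimal family of bihomogeneous generators with these bidegrees, and every minimal family of
bihomogeneous generators has the same number of members and, up to order, the same bidegrees.
(A minimal family is injective, so index types in the universe of `K` are enough.) -/
def HasMinimalGeneratorsInBidegrees (M : Submodule (FirstRing K) (CoordRing K)) {n : ℕ}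
    (d : Fin n → ℕ × ℕ) : Prop :=
  (∃ g : Fin n → CoordRing K, IsMinimalGenerators M g d) ∧
    ∀ (ι : Type u) (g : ι → CoordRing K) (e : ι → ℕ × ℕ), IsMinimalGenerators M g e →
      ∃ σ : ι ≃ Fin n, ∀ i, e i = d (σ i)

end BiProj

end

/-! By graded Nakayama, the generators of bidegree `c` in any minimal bihomogeneous system form a
basis of the bidegree `c` part of `M/⟨s,t⟩M`, and lifts of such bases form a minimal system. So only
the dimensions of these quotients matter (`hasMinimalGeneratorsInBidegrees_of_finrank`).

Put `V_i = (I_X)_{(i,1)}` and `v_i = dim V_i`. The decomposable part in first degree `i + 2` is `s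
V_{i+1} + t V_{i+1}`. Since `s, t` are coprime and do not both vanish at a point of `ℙ¹`, the two
summands meet in `st V_i`. The quotient therefore has dimension `v_{i+2} - 2 v_{i+1} + v_i`.
Genericity gives `v_i = max (2(i+1) - r) 0`, whose second difference is 1 at each of `r/2` and
`(r+1)/2` (rounded down), 2 if they coincide, and 0 elsewhere. -/

noncomputable section
namespace BiProj

open MvPolynomial

variable {K : Type u} [Field K]

/-! ### Graded pieces and decomposable elements. -/

/-- The forms of bidegree `c` in a `K[s, t]`-submodule of `K[s, t, u, v]`. -/
def gradedPart (M : Submodule (FirstRing K) (CoordRing K)) (c : ℕ × ℕ) :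
    Submodule K (CoordRing K) :=
  M.restrictScalars K ⊓ forms K c

/-- The part of bidegree `c` of `⟨s, t⟩ M`. -/
def decomposables (M : Submodule (FirstRing K) (CoordRing K)) (c : ℕ × ℕ) :
    Submodule K (CoordRing K) :=
  Submodule.span K
    {f | ∃ n c', ∃ h ∈ gradedPart M c', (1, 0) + c' = c ∧ f = X (Sum.inl n) * h}

instance finite_gradedPart (M : Submodule (FirstRing K) (CoordRing K)) (c : ℕ × ℕ) :
    Module.Finite K (gradedPart M c) :=
  haveI := finite_forms (K := K) c
  Submodule.finiteDimensional_of_le inf_le_right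

theorem X_inl_mul_eq_smul (n : Fin 2) (h : CoordRing K) :
    X (Sum.inl n) * h = (X n : FirstRing K) • h := by
  rw [firstRing_smul_def, rename_X]

theorem X_inl_mul_mem_forms (n : Fin 2) {h : CoordRing K} {c : ℕ × ℕ} (hh : h ∈ forms K c) :
    X (Sum.inl n) * h ∈ forms K ((1, 0) + c) :=
  (isWeightedHomogeneous_X K bidegree (Sum.inl n)).mul hh

theorem X_inl_mul_mem_gradedPart {M : Submodule (FirstRing K) (CoordRing K)} (n : Fin 2)
    {h : CoordRing K} {c : ℕ × ℕ} (hh : h ∈ gradedPart M c) :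
    X (Sum.inl n) * h ∈ gradedPart M ((1, 0) + c) := by
  refine ⟨?_, X_inl_mul_mem_forms n hh.2⟩
  rw [X_inl_mul_eq_smul]
  exact M.smul_mem _ hh.1

theorem decomposables_le_gradedPart (M : Submodule (FirstRing K) (CoordRing K)) (c : ℕ × ℕ) :
    decomposables M c ≤ gradedPart M c := by
  refine Submodule.span_le.2 ?_
  rintro _ ⟨n, c', h, hh, rfl, rfl⟩
  exact X_inl_mul_mem_gradedPart n hh

instance finite_decomposables (M : Submodule (FirstRing K) (CoordRing K)) (c : ℕ × ℕ) :
    Module.Finite K (decomposables M c) :=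
  Submodule.finiteDimensional_of_le (decomposables_le_gradedPart M c)

theorem decomposables_mono {M N : Submodule (FirstRing K) (CoordRing K)} (h : M ≤ N)
    (c : ℕ × ℕ) : decomposables M c ≤ decomposables N c := by
  refine Submodule.span_mono ?_
  rintro _ ⟨n, c', f, hf, rfl, rfl⟩
  exact ⟨n, c', f, ⟨h hf.1, hf.2⟩, rfl, rfl⟩

theorem mem_of_mem_decomposables {M N : Submodule (FirstRing K) (CoordRing K)} {c : ℕ × ℕ}
    (h : ∀ c', (1, 0) + c' = c → ∀ f ∈ gradedPart M c', f ∈ N) :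
    ∀ f ∈ decomposables M c, f ∈ N := by
  change decomposables M c ≤ N.restrictScalars K
  refine Submodule.span_le.2 ?_
  rintro _ ⟨n, c', f, hf, hc, rfl⟩
  rw [X_inl_mul_eq_smul]
  exact N.smul_mem _ (h c' hc f hf)

/-! ### Graded Nakayama: minimal generators and bases of `M/⟨s,t⟩M`. -/

section Generators

variable {ι : Type*} {g : ι → CoordRing K} {e : ι → ℕ × ℕ}

/-- Split a combination into monomial multiples of generators and keep bidegree `c`: the monomial 1
contributes a generator, and any other monomial has a variable to factor out. The index set `I`
allows one generator to be omitted. -/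
theorem gradedPart_span_le (hg : ∀ i, g i ∈ forms K (e i)) (I : Set ι) (c : ℕ × ℕ) :
    gradedPart (Submodule.span (FirstRing K) (g '' I)) c ≤
      Submodule.span K (g '' {i ∈ I | e i = c}) ⊔
        decomposables (Submodule.span (FirstRing K) (g '' I)) c := by
  classical
  set N := Submodule.span (FirstRing K) (g '' I) with hN
  set W := Submodule.span K (g '' {i ∈ I | e i = c}) ⊔ decomposables N c with hW
  have hmon : ∀ m i, g i ∈ forms K (e i) →
      (monomial m 1 : FirstRing K) • g i ∈
        forms K (Finsupp.weight bidegree (m.mapDomain Sum.inl) + e i) := by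
    intro m i hi
    rw [firstRing_smul_def, rename_monomial]
    exact (isWeightedHomogeneous_monomial bidegree _ 1 rfl).mul hi
  suffices h : ∀ f ∈ N.restrictScalars K, weightedHomogeneousComponent bidegree c f ∈ W by
    intro f hf
    have := h f hf.1
    rwa [IsWeightedHomogeneous.weightedHomogeneousComponent_same hf.2] at this
  intro f hf
  rw [hN, ← Submodule.span_smul_of_span_eq_top (basisMonomials (Fin 2) K).span_eq] at hf
  induction hf using Submodule.span_induction with
  | zero => simp
  | add a b _ _ ha hb => rw [map_add]; exact W.add_mem ha hb
  | smul a b _ hb => rw [map_smul]; exact W.smul_mem _ hb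
  | mem f hf =>
    obtain ⟨_, ⟨m, rfl⟩, _, ⟨i, hi, rfl⟩, rfl⟩ := Set.mem_smul.1 hf
    simp only [coe_basisMonomials]
    rw [weightedHomogeneousComponent_of_mem (hmon m i (hg i))]
    split_ifs with hc
    swap
    · exact W.zero_mem
    by_cases hm : m = 0
    · subst hm
      refine Submodule.mem_sup_left (Submodule.subset_span ⟨i, ⟨hi, ?_⟩, ?_⟩)
      · simpa using hc.symm
      · simp
    · obtain ⟨n, hn⟩ : ∃ n, m n ≠ 0 := by
        by_contra! h
        exact hm (Finsupp.ext h)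
      obtain ⟨m', rfl⟩ : ∃ m', m = Finsupp.single n 1 + m' :=
        ⟨m - Finsupp.single n 1, (add_tsub_cancel_of_le (by
          simpa [Finsupp.single_le_iff] using Nat.one_le_iff_ne_zero.2 hn)).symm⟩
      refine Submodule.mem_sup_right (Submodule.subset_span
        ⟨n, _, (monomial m' 1 : FirstRing K) • g i, ⟨?_, hmon m' i (hg i)⟩, ?_, ?_⟩)
      · exact N.smul_mem _ (Submodule.subset_span ⟨i, hi, rfl⟩)
      · rw [hc, Finsupp.mapDomain_add, map_add, add_assoc, Finsupp.mapDomain_single,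
          Finsupp.weight_single]
        simp [bidegree]
      · rw [X_inl_mul_eq_smul, smul_smul, X, monomial_mul, one_mul]

variable {M : Submodule (FirstRing K) (CoordRing K)}

theorem IsMinimalGenerators.mem_gradedPart (h : IsMinimalGenerators M g e) (i : ι) :
    g i ∈ gradedPart M (e i) :=
  ⟨h.span_eq ▸ Submodule.subset_span ⟨i, rfl⟩, h.homogeneous i⟩

theorem IsMinimalGenerators.gradedPart_le (h : IsMinimalGenerators M g e) (c : ℕ × ℕ) :
    gradedPart M c ≤ Submodule.span K (g '' {i | e i = c}) ⊔ decomposables M c := by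
  have := gradedPart_span_le h.homogeneous Set.univ c
  rw [Set.image_univ, h.span_eq] at this
  simpa using this

/-- Multiplication by `s, t` only raises the first degree, so a generator cannot contribute below
its own. -/
theorem IsMinimalGenerators.gradedPart_le_of_lt (h : IsMinimalGenerators M g e) (i : ι) (n : ℕ)
    (c : ℕ × ℕ) (hn : c.1 = n) (hc : n < (e i).1) :
    gradedPart M c ≤ (Submodule.span (FirstRing K) (g '' {i}ᶜ)).restrictScalars K := by
  induction n generalizing c with
  | zero | succ n ih =>
    refine (h.gradedPart_le c).trans (sup_le (Submodule.span_le.2 ?_) ?_)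
    · rintro _ ⟨j, rfl, rfl⟩
      refine Submodule.subset_span ⟨j, ?_, rfl⟩
      rintro rfl
      omega
    · refine mem_of_mem_decomposables fun c' hc' => ?_
      have := congrArg Prod.fst hc'
      simp only [Prod.fst_add] at this
      -- In first degree 0 there is no such `c'`; otherwise induction applies.
      first
        | omega
        | exact ih c' (by omega) (by omega)

/-- Decomposables of bidegree `e i` come from lower first degree, where `g i` is not needed, so
membership would make `g i` redundant. -/
theorem IsMinimalGenerators.notMem_sup_decomposables (h : IsMinimalGenerators M g e) (i : ι) :
    g i ∉ Submodule.span K (g '' {j | j ≠ i ∧ e j = e i}) ⊔ decomposables M (e i) := by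
  intro hi
  refine h.irredundant i ?_
  suffices Submodule.span K (g '' {j | j ≠ i ∧ e j = e i}) ⊔ decomposables M (e i) ≤
    (Submodule.span (FirstRing K) (g '' {i}ᶜ)).restrictScalars K from this hi
  refine sup_le (Submodule.span_le.2 ?_) ?_
  · rintro _ ⟨j, hj, rfl⟩
    exact Submodule.subset_span ⟨j, hj.1, rfl⟩
  · refine mem_of_mem_decomposables fun c' hc' => ?_
    refine h.gradedPart_le_of_lt i _ c' rfl ?_
    have := congrArg Prod.fst hc'
    simp only [Prod.fst_add] at this
    omega

/-- The part of bidegree `c` of `M / ⟨s, t⟩ M`. -/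
def indecomposables (M : Submodule (FirstRing K) (CoordRing K)) (c : ℕ × ℕ) :
    Submodule K (CoordRing K ⧸ decomposables M c) :=
  (gradedPart M c).map (decomposables M c).mkQ

instance finite_indecomposables (M : Submodule (FirstRing K) (CoordRing K)) (c : ℕ × ℕ) :
    Module.Finite K (indecomposables M c) := by
  unfold indecomposables; infer_instance

theorem finrank_indecomposables (M : Submodule (FirstRing K) (CoordRing K)) (c : ℕ × ℕ) :
    Module.finrank K (indecomposables M c) + Module.finrank K (decomposables M c) =
      Module.finrank K (gradedPart M c) := by
  have h := ((decomposables M c).mkQ.domRestrict (gradedPart M c)).finrank_range_add_finrank_ker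
  rw [LinearMap.range_domRestrict, LinearMap.ker_domRestrict, Submodule.ker_mkQ] at h
  rw [← h, indecomposables,
    (Submodule.comapSubtypeEquivOfLe (decomposables_le_gradedPart M c)).finrank_eq]

theorem notMem_span_iff_of_fiber (N : Submodule K (CoordRing K)) (c : ℕ × ℕ)
    (i : {i // e i = c}) :
    N.mkQ (g i) ∉ Submodule.span K ((fun j : {i // e i = c} => N.mkQ (g j)) '' (Set.univ \ {i})) ↔
      g i ∉ Submodule.span K (g '' {j | j ≠ i ∧ e j = c}) ⊔ N := by
  have : (fun j : {i // e i = c} => N.mkQ (g j)) '' (Set.univ \ {i}) =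
      N.mkQ '' (g '' {j | j ≠ i ∧ e j = c}) := by
    ext x
    constructor
    · rintro ⟨j, hj, rfl⟩
      exact ⟨_, ⟨j, ⟨fun h => hj.2 (Subtype.ext h), j.2⟩, rfl⟩, rfl⟩
    · rintro ⟨_, ⟨j, hj, rfl⟩, rfl⟩
      exact ⟨⟨j, hj.2⟩, ⟨trivial, fun h => hj.1 (congrArg Subtype.val h)⟩, rfl⟩
  rw [this, Submodule.span_image, ← Submodule.mem_comap, Submodule.comap_map_mkQ, sup_comm]

theorem IsMinimalGenerators.linearIndependent (h : IsMinimalGenerators M g e) (c : ℕ × ℕ) :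
    LinearIndependent K fun i : {i // e i = c} => (decomposables M c).mkQ (g i) := by
  refine linearIndependent_iff_notMem_span.2 fun i => ?_
  rw [notMem_span_iff_of_fiber]
  obtain ⟨i, rfl⟩ := i
  exact h.notMem_sup_decomposables i

theorem IsMinimalGenerators.span_eq_indecomposables (h : IsMinimalGenerators M g e) (c : ℕ × ℕ) :
    Submodule.span K (Set.range fun i : {i // e i = c} => (decomposables M c).mkQ (g i)) =
      indecomposables M c := by
  apply le_antisymm
  · refine Submodule.span_le.2 ?_
    rintro _ ⟨⟨i, rfl⟩, rfl⟩
    exact ⟨_, h.mem_gradedPart i, rfl⟩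
  · refine (Submodule.map_mono (h.gradedPart_le c)).trans ?_
    rw [Submodule.map_sup, Submodule.mkQ_map_self, sup_bot_eq, Submodule.map_span]
    refine Submodule.span_mono ?_
    rintro _ ⟨_, ⟨i, hi, rfl⟩, rfl⟩
    exact ⟨⟨i, hi⟩, rfl⟩

/-- The members of bidegree `c` of a minimal family of generators form a basis of the part of
bidegree `c` of `M / ⟨s, t⟩ M`. -/
def IsMinimalGenerators.basis (h : IsMinimalGenerators M g e) (c : ℕ × ℕ) :
    Module.Basis {i // e i = c} K (indecomposables M c) :=
  (Module.Basis.span (h.linearIndependent c)).map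
    (LinearEquiv.ofEq _ _ (h.span_eq_indecomposables c))

/-- Generation follows by induction on the first degree. A redundant generator would, by
`gradedPart_span_le`, give a linear dependence modulo decomposables. -/
theorem isMinimalGenerators_of_basis (hM : M.restrictScalars K ≤ ⨆ c, gradedPart M c)
    (hg : ∀ i, g i ∈ gradedPart M (e i))
    (hli : ∀ c, LinearIndependent K fun i : {i // e i = c} => (decomposables M c).mkQ (g i))
    (hsp : ∀ c, indecomposables M c ≤
      Submodule.span K (Set.range fun i : {i // e i = c} => (decomposables M c).mkQ (g i))) :
    IsMinimalGenerators M g e where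
  homogeneous i := (hg i).2
  span_eq := by
    have hle : ∀ c, gradedPart M c ≤
        (Submodule.span (FirstRing K) (Set.range g)).restrictScalars K := by
      intro c
      induction hn : c.1 generalizing c with
      | zero | succ n ih =>
        intro f hf
        have hf' := hsp c ⟨f, hf, rfl⟩
        have : (Set.range fun i : {i // e i = c} => (decomposables M c).mkQ (g i)) =
            (decomposables M c).mkQ '' (Set.range fun i : {i // e i = c} => g i) := by
          rw [← Set.range_comp]; rfl
        rw [this, Submodule.span_image, ← Submodule.mem_comap, Submodule.comap_map_mkQ] at hf'
        refine SetLike.le_def.1 (sup_le ?_ (Submodule.span_le.2 ?_)) hf'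
        · refine mem_of_mem_decomposables fun c' hc' => ?_
          have := congrArg Prod.fst hc'
          simp only [Prod.fst_add] at this
          first
            | omega
            | exact ih c' (by omega)
        · rintro _ ⟨i, rfl⟩
          exact Submodule.subset_span ⟨i, rfl⟩
    apply le_antisymm
    · refine Submodule.span_le.2 ?_
      rintro _ ⟨i, rfl⟩
      exact (hg i).1
    · exact fun f hf => iSup_le hle (hM hf)
  irredundant i hi := by
    have h1 := gradedPart_span_le (fun i => (hg i).2) {i}ᶜ (e i) ⟨hi, (hg i).2⟩
    have h2 := (notMem_span_iff_of_fiber _ _ _).1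
      (linearIndependent_iff_notMem_span.1 (hli (e i)) ⟨i, rfl⟩)
    refine h2 (SetLike.le_def.1 (sup_le_sup_left (decomposables_mono ?_ _) _) h1)
    refine Submodule.span_le.2 ?_
    rintro _ ⟨j, _, rfl⟩
    exact (hg j).1

end Generators

theorem hasMinimalGeneratorsInBidegrees_of_finrank
    {M : Submodule (FirstRing K) (CoordRing K)}
    (hM : M.restrictScalars K ≤ ⨆ c, gradedPart M c) {n : ℕ} (d : Fin n → ℕ × ℕ)
    (hd : ∀ c, Module.finrank K (indecomposables M c) = Fintype.card {i // d i = c}) :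
    HasMinimalGeneratorsInBidegrees M d := by
  constructor
  · let b : ∀ c, Module.Basis {i // d i = c} K (indecomposables M c) := fun c =>
      (Module.finBasisOfFinrankEq K _ (hd c)).reindex (Fintype.equivFin _).symm
    have hb : ∀ i, ∃ f ∈ gradedPart M (d i), (decomposables M (d i)).mkQ f = b (d i) ⟨i, rfl⟩ :=
      fun i => (b (d i) ⟨i, rfl⟩).2
    choose g hg hgb using hb
    have hfam : ∀ c, (fun i : {i // d i = c} => (decomposables M c).mkQ (g i)) =
        (indecomposables M c).subtype ∘ b c := by
      intro c
      ext ⟨i, rfl⟩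
      exact hgb i
    refine ⟨g, isMinimalGenerators_of_basis hM hg (fun c => ?_) fun c => ?_⟩
    · rw [hfam]
      exact (b c).linearIndependent.map' _ (Submodule.ker_subtype _)
    · rw [hfam, Set.range_comp, Submodule.span_image, (b c).span_eq, Submodule.map_subtype_top]
  · intro ι g e h
    have key : ∀ c, Nonempty ({i // e i = c} ≃ {i // d i = c}) := by
      intro c
      have := Module.Finite.finite_basis (h.basis c)
      rw [← Finite.card_eq, ← Module.finrank_eq_nat_card_basis (h.basis c), hd, Nat.card_eq_fintype_card]
    -- Bijections between the fibres of `e` and `d` over each bidegree glue to the required `σ`.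
    refine ⟨Equiv.ofFiberEquiv (fun c => (key c).some), fun i => ?_⟩
    exact (Equiv.ofFiberEquiv_map _ i).symm

/-! ### Point ideals and saturation with respect to `s, t`. -/

/-- The restriction of functions to the affine cone over the point `[a] × [b]`. -/
def restrictToCone (a b : Fin 2 → K) : CoordRing K →ₐ[K] MvPolynomial (Fin 2) K :=
  aeval (Sum.elim (fun i => C (a i) * X 0) (fun i => C (b i) * X 1))

theorem exists_mul_add_mul_eq_one {a : Fin 2 → K} (ha : a ≠ 0) :
    ∃ x y : K, x * a 0 + y * a 1 = 1 := by
  by_cases h : a 0 = 0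
  · have h1 : a 1 ≠ 0 := fun h1 => ha (by ext i; fin_cases i <;> simp [h, h1])
    exact ⟨0, (a 1)⁻¹, by simp [h1]⟩
  · exact ⟨(a 0)⁻¹, 0, by simp [h]⟩

theorem span_lines_eq_ker {a b : Fin 2 → K} (ha : a ≠ 0) (hb : b ≠ 0) :
    Ideal.span {lineFst a, lineSnd b} = RingHom.ker (restrictToCone a b) := by
  set I : Ideal (CoordRing K) := Ideal.span {lineFst a, lineSnd b} with hI
  have h1 : lineFst a ∈ I := Ideal.subset_span (by simp)
  have h2 : lineSnd b ∈ I := Ideal.subset_span (by simp)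
  apply le_antisymm
  · refine Ideal.span_le.2 ?_
    rintro _ (rfl | rfl)
    · simp only [SetLike.mem_coe, RingHom.mem_ker, restrictToCone, lineFst, map_sub, map_mul,
        aeval_X, algHom_C, algebraMap_eq, Sum.elim_inl]
      ring
    · simp only [SetLike.mem_coe, RingHom.mem_ker, restrictToCone, lineSnd, map_sub, map_mul,
        aeval_X, algHom_C, algebraMap_eq, Sum.elim_inr]
      ring
  · obtain ⟨x, y, hxy⟩ := exists_mul_add_mul_eq_one ha
    obtain ⟨z, w, hzw⟩ := exists_mul_add_mul_eq_one hb
    -- The two cone coordinates go to linear forms with value 1 at `a` and at `b`. Then restriction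
    -- followed by `ψ` is the identity modulo `I`, which puts the kernel inside `I`.
    let ψ : MvPolynomial (Fin 2) K →ₐ[K] CoordRing K :=
      aeval ![C x * X (Sum.inl 0) + C y * X (Sum.inl 1), C z * X (Sum.inr 0) + C w * X (Sum.inr 1)]
    have hxy' : (C x * C (a 0) + C y * C (a 1) : CoordRing K) = 1 := by
      rw [← C_mul, ← C_mul, ← C_add, hxy, C_1]
    have hzw' : (C z * C (b 0) + C w * C (b 1) : CoordRing K) = 1 := by
      rw [← C_mul, ← C_mul, ← C_add, hzw, C_1]
    have key : (Ideal.Quotient.mkₐ K I).comp (ψ.comp (restrictToCone a b)) =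
        Ideal.Quotient.mkₐ K I := by
      refine algHom_ext fun i => Ideal.Quotient.eq.2 ?_
      rcases i with i | i <;> fin_cases i <;>
        simp only [restrictToCone, ψ, AlgHom.comp_apply, aeval_X,
          Sum.elim_inl, Sum.elim_inr, map_mul, algHom_C, algebraMap_eq, RingHom.coe_coe,
          Matrix.cons_val_zero, Matrix.cons_val_one, Fin.zero_eta, Fin.mk_one, Fin.isValue]
      · convert I.mul_mem_left (-C y) h1 using 1
        rw [lineFst]
        linear_combination X (Sum.inl 0) * hxy'
      · convert I.mul_mem_left (C x) h1 using 1
        rw [lineFst]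
        linear_combination X (Sum.inl 1) * hxy'
      · convert I.mul_mem_left (-C w) h2 using 1
        rw [lineSnd]
        linear_combination X (Sum.inr 0) * hzw'
      · convert I.mul_mem_left (C z) h2 using 1
        rw [lineSnd]
        linear_combination X (Sum.inr 1) * hzw'
    intro f hf
    rw [RingHom.mem_ker] at hf
    have := DFunLike.congr_fun key f
    rw [AlgHom.comp_apply, AlgHom.comp_apply, hf, map_zero, map_zero] at this
    exact Ideal.Quotient.eq_zero_iff_mem.1 this.symm

/-- The point ideal is the kernel of a map to a domain, and one of `s, t` has nonzero image because
some coordinate of the point is nonzero. -/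
theorem mem_pointIdeal_of_X_mul_mem (P : ℙ K (Fin 2 → K) × ℙ K (Fin 2 → K)) {h : CoordRing K}
    (hh : ∀ n, X (Sum.inl n) * h ∈ pointIdeal P) : h ∈ pointIdeal P := by
  rw [pointIdeal, span_lines_eq_ker P.1.rep_nonzero P.2.rep_nonzero] at hh ⊢
  obtain ⟨n, hn⟩ := Function.ne_iff.1 P.1.rep_nonzero
  have := hh n
  rw [RingHom.mem_ker, map_mul, mul_eq_zero] at this
  refine this.resolve_left ?_
  rw [restrictToCone, aeval_X, Sum.elim_inl]
  exact mul_ne_zero (C_ne_zero.2 hn) (X_ne_zero _)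

theorem mem_pointsIdeal_of_X_mul_mem (X : Finset (ℙ K (Fin 2 → K) × ℙ K (Fin 2 → K)))
    {h : CoordRing K} (hh : ∀ n, MvPolynomial.X (Sum.inl n) * h ∈ pointsIdeal X) :
    h ∈ pointsIdeal X := by
  simp only [pointsIdeal, Ideal.mem_iInf] at hh ⊢
  exact fun P hP => mem_pointIdeal_of_X_mul_mem P fun n => hh n P hP

/-! ### Graded pieces of `moduleM`. -/

theorem mem_moduleM {I : Ideal (CoordRing K)} {f : CoordRing K} :
    f ∈ moduleM I ↔ f ∈ ⨆ i : ℕ, idealForms I (i, 1) := Iff.rfl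

theorem idealForms_le_gradedPart (I : Ideal (CoordRing K)) (i : ℕ) :
    idealForms I (i, 1) ≤ gradedPart (moduleM I) (i, 1) := fun _ hf =>
  ⟨mem_moduleM.2 (Submodule.mem_iSup_of_mem i hf), hf.2⟩

theorem gradedPart_moduleM (I : Ideal (CoordRing K)) (i : ℕ) :
    gradedPart (moduleM I) (i, 1) = idealForms I (i, 1) := by
  refine le_antisymm (fun f hf => ⟨?_, hf.2⟩) (idealForms_le_gradedPart I i)
  exact (iSup_le fun _ => inf_le_left : ⨆ i : ℕ, idealForms I (i, 1) ≤ I.restrictScalars K) hf.1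

theorem gradedPart_moduleM_eq_bot (I : Ideal (CoordRing K)) {c : ℕ × ℕ} (hc : c.2 ≠ 1) :
    gradedPart (moduleM I) c = ⊥ := by
  have hle : ⨆ i : ℕ, idealForms I (i, 1) ≤
      restrictSupport K {m | (Finsupp.weight bidegree m).2 = 1} := by
    refine iSup_le fun i f hf => (mem_restrictSupport_iff K).2 fun m hm => ?_
    exact congrArg Prod.snd (hf.2 (mem_support_iff.1 hm))
  refine eq_bot_iff.2 fun f hf => ?_
  by_contra hf0
  obtain ⟨m, hm⟩ := ne_zero_iff.1 hf0
  have h1 := (mem_restrictSupport_iff K).1 (hle hf.1) (mem_support_iff.2 hm)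
  exact hc ((congrArg Prod.snd (hf.2 hm)).symm.trans h1)

theorem moduleM_le_iSup_gradedPart (I : Ideal (CoordRing K)) :
    (moduleM I).restrictScalars K ≤ ⨆ c, gradedPart (moduleM I) c := fun _ hf =>
  (iSup_le fun i => (idealForms_le_gradedPart I i).trans
    (le_iSup (gradedPart (moduleM I)) (i, 1)) : ⨆ i : ℕ, idealForms I (i, 1) ≤ _) hf

/-! ### Dimensions of forms and of decomposables. -/

theorem weight_bidegree (m : Fin 2 ⊕ Fin 2 →₀ ℕ) :
    Finsupp.weight bidegree m =
      (m (Sum.inl 0) + m (Sum.inl 1), m (Sum.inr 0) + m (Sum.inr 1)) := by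
  rw [Finsupp.weight_apply, Finsupp.sum_fintype _ _ (by simp)]
  ext <;> simp [bidegree, Fintype.sum_sum_type]

theorem finrank_forms (i j : ℕ) :
    Module.finrank K (forms K (i, j)) = (i + 1) * (j + 1) := by
  have h : forms K (i, j) = restrictSupport K {m | Finsupp.weight bidegree m = (i, j)} :=
    weightedHomogeneousSubmodule_eq_finsupp_supported K bidegree (i, j)
  rw [h, Module.finrank_eq_nat_card_basis (basisRestrictSupport K _)]
  let φ : Fin (i + 1) × Fin (j + 1) →
      {m : Fin 2 ⊕ Fin 2 →₀ ℕ | Finsupp.weight bidegree m = (i, j)} := fun x =>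
    ⟨Finsupp.equivFunOnFinite.symm
      (Sum.elim ![(x.1 : ℕ), i - x.1] ![(x.2 : ℕ), j - x.2]), by
        rw [Set.mem_ofPred_eq, weight_bidegree]
        simp
        omega⟩
  have hφ : Function.Bijective φ := by
    constructor
    · intro x y hxy
      have h1 := congrArg Subtype.val hxy
      have h2 := DFunLike.congr_fun h1 (Sum.inl 0)
      have h3 := DFunLike.congr_fun h1 (Sum.inr 0)
      simp only [φ, Finsupp.equivFunOnFinite_symm_apply_apply, Sum.elim_inl, Sum.elim_inr,
        Matrix.cons_val_zero] at h2 h3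
      exact Prod.ext (Fin.ext h2) (Fin.ext h3)
    · rintro ⟨m, hm⟩
      rw [Set.mem_ofPred_eq, weight_bidegree, Prod.mk.injEq] at hm
      refine ⟨(⟨m (Sum.inl 0), by omega⟩, ⟨m (Sum.inr 0), by omega⟩), Subtype.ext ?_⟩
      ext x
      rcases x with x | x <;> fin_cases x <;> simp [φ] <;> omega
  rw [← Nat.card_eq_of_bijective φ hφ]
  simp

theorem finrank_idealForms_add_hilbertFunction
    (X : Finset (ℙ K (Fin 2 → K) × ℙ K (Fin 2 → K))) (i j : ℕ) :
    Module.finrank K (idealForms (pointsIdeal X) (i, j)) + hilbertFunction X i j =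
      (i + 1) * (j + 1) := by
  have := finrank_idealForms_le (pointsIdeal X) (i, j)
  rw [hilbertFunction]
  rw [finrank_forms] at *
  omega

theorem decomposables_zero (M : Submodule (FirstRing K) (CoordRing K)) (j : ℕ) :
    decomposables M (0, j) = ⊥ := by
  refine eq_bot_iff.2 (Submodule.span_le.2 ?_)
  rintro _ ⟨n, c', h, hh, hc, rfl⟩
  have := congrArg Prod.fst hc
  simp only [Prod.fst_add] at this
  omega

theorem decomposables_succ (M : Submodule (FirstRing K) (CoordRing K)) (i j : ℕ) :
    decomposables M (i + 1, j) =
      (gradedPart M (i, j)).map (LinearMap.mulLeft K (X (Sum.inl 0))) ⊔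
        (gradedPart M (i, j)).map (LinearMap.mulLeft K (X (Sum.inl 1))) := by
  apply le_antisymm
  · refine Submodule.span_le.2 ?_
    rintro _ ⟨n, c', h, hh, hc, rfl⟩
    obtain rfl : c' = (i, j) := by
      simp only [Prod.ext_iff, Prod.fst_add, Prod.snd_add] at hc
      ext <;> omega
    fin_cases n
    · exact Submodule.mem_sup_left ⟨h, hh, rfl⟩
    · exact Submodule.mem_sup_right ⟨h, hh, rfl⟩
  · refine sup_le ?_ ?_
    all_goals
      rintro _ ⟨h, hh, rfl⟩
      exact Submodule.subset_span ⟨_, (i, j), h, hh, by simp [add_comm], rfl⟩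

theorem finrank_map_mulLeft (V : Submodule K (CoordRing K)) {f : CoordRing K} (hf : f ≠ 0) :
    Module.finrank K (V.map (LinearMap.mulLeft K f)) = Module.finrank K V :=
  (Submodule.equivMapOfInjective _ (mul_right_injective₀ hf) V).finrank_eq.symm

theorem exists_of_X_mul_eq_X_mul {f g : CoordRing K}
    (h : X (Sum.inl 0) * f = X (Sum.inl 1) * g) :
    ∃ q, f = X (Sum.inl 1) * q ∧ g = X (Sum.inl 0) * q := by
  have hd : (X (Sum.inl 1) : CoordRing K) ∣ X (Sum.inl 0) * f := ⟨g, h⟩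
  rw [X_dvd_mul_iff, X_dvd_X] at hd
  obtain ⟨q, rfl⟩ := hd.resolve_left (by simp)
  refine ⟨q, rfl, mul_left_cancel₀ (X_ne_zero (Sum.inl 1)) ?_⟩
  rw [← h]; ring

theorem mem_forms_of_X_mul_mem {n : Fin 2} {h : CoordRing K} {i j : ℕ}
    (hh : X (Sum.inl n) * h ∈ forms K (i + 1, j)) : h ∈ forms K (i, j) := by
  intro m hm
  rw [← coeff_X_mul m (Sum.inl n)] at hm
  have := hh hm
  rw [map_add, Finsupp.weight_single, Prod.ext_iff] at this
  simp only [show bidegree (Sum.inl n) = (1, 0) from rfl, one_smul, Prod.fst_add,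
    Prod.snd_add] at this
  exact Prod.ext (by omega) (by omega)

theorem eq_zero_of_X_mul_mem_forms {n : Fin 2} {h : CoordRing K} {j : ℕ}
    (hh : X (Sum.inl n) * h ∈ forms K (0, j)) : h = 0 := by
  by_contra h0
  obtain ⟨m, hm⟩ := ne_zero_iff.1 h0
  rw [← coeff_X_mul m (Sum.inl n)] at hm
  have := congrArg Prod.fst (hh hm)
  rw [map_add, Finsupp.weight_single] at this
  simp [bidegree] at this

theorem finrank_sup_add_finrank_inf (V W : Submodule K (CoordRing K)) [Module.Finite K V]
    [Module.Finite K W] :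
    Module.finrank K ↥(V ⊔ W) + Module.finrank K ↥(V ⊓ W) =
      Module.finrank K V + Module.finrank K W :=
  Submodule.finrank_sup_add_finrank_inf_eq V W

section Recursion

variable {I : Ideal (CoordRing K)}

/-- Boundary case of the recursion: the common factor `q` would have first degree -1, so the
intersection vanishes. -/
theorem finrank_decomposables_one :
    Module.finrank K (decomposables (moduleM I) (1, 1)) =
      2 * Module.finrank K (idealForms I (0, 1)) := by
  have h := finrank_sup_add_finrank_inf
    ((gradedPart (moduleM I) (0, 1)).map (LinearMap.mulLeft K (X (Sum.inl 0))))
    ((gradedPart (moduleM I) (0, 1)).map (LinearMap.mulLeft K (X (Sum.inl 1))))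
  have hinf : (gradedPart (moduleM I) (0, 1)).map (LinearMap.mulLeft K (X (Sum.inl 0))) ⊓
      (gradedPart (moduleM I) (0, 1)).map (LinearMap.mulLeft K (X (Sum.inl 1))) = ⊥ := by
    refine eq_bot_iff.2 ?_
    rintro _ ⟨⟨f, hf, rfl⟩, ⟨g, hg, hgf⟩⟩
    obtain ⟨q, rfl, rfl⟩ := exists_of_X_mul_eq_X_mul hgf.symm
    rw [eq_zero_of_X_mul_mem_forms hf.2]
    simp
  rw [hinf, finrank_bot, ← decomposables_succ, zero_add, finrank_map_mulLeft _ (X_ne_zero _),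
    finrank_map_mulLeft _ (X_ne_zero _), gradedPart_moduleM] at h
  omega

theorem finrank_decomposables_add_two (hI : ∀ h, (∀ n, X (Sum.inl n) * h ∈ I) → h ∈ I) (i : ℕ) :
    Module.finrank K (decomposables (moduleM I) (i + 2, 1)) +
        Module.finrank K (idealForms I (i, 1)) =
      2 * Module.finrank K (idealForms I (i + 1, 1)) := by
  have h := finrank_sup_add_finrank_inf
    ((gradedPart (moduleM I) (i + 1, 1)).map (LinearMap.mulLeft K (X (Sum.inl 0))))
    ((gradedPart (moduleM I) (i + 1, 1)).map (LinearMap.mulLeft K (X (Sum.inl 1))))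
  have hinf : (gradedPart (moduleM I) (i + 1, 1)).map (LinearMap.mulLeft K (X (Sum.inl 0))) ⊓
      (gradedPart (moduleM I) (i + 1, 1)).map (LinearMap.mulLeft K (X (Sum.inl 1))) =
      (idealForms I (i, 1)).map (LinearMap.mulLeft K (X (Sum.inl 0) * X (Sum.inl 1))) := by
    rw [gradedPart_moduleM]
    apply le_antisymm
    · rintro _ ⟨⟨f, hf, rfl⟩, ⟨g, hg, hgf⟩⟩
      obtain ⟨q, rfl, rfl⟩ := exists_of_X_mul_eq_X_mul hgf.symm
      -- Here `f = t q` and `g = s q` both lie in `I`, so saturation gives `q ∈ I`.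
      refine ⟨q, ⟨hI q fun n => ?_, mem_forms_of_X_mul_mem hf.2⟩, mul_assoc _ _ _⟩
      fin_cases n
      · exact hg.1
      · exact hf.1
    · rintro _ ⟨f, hf, rfl⟩
      have hX : ∀ n, X (Sum.inl n) * f ∈ idealForms I (i + 1, 1) := fun n =>
        ⟨I.mul_mem_left _ hf.1, by simpa [add_comm] using X_inl_mul_mem_forms n hf.2⟩
      refine ⟨⟨_, hX 1, (mul_assoc _ _ _).symm⟩, ⟨_, hX 0, ?_⟩⟩
      simp only [LinearMap.mulLeft_apply]
      ring
  rw [hinf, ← decomposables_succ, add_assoc, one_add_one_eq_two, finrank_map_mulLeft _ (X_ne_zero _),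
    finrank_map_mulLeft _ (X_ne_zero _),
    finrank_map_mulLeft _ (mul_ne_zero (X_ne_zero _) (X_ne_zero _)), gradedPart_moduleM] at h
  omega

end Recursion

/-! ### Generator counts for a generic set. -/

theorem finrank_indecomposables_eq_zero (I : Ideal (CoordRing K)) {c : ℕ × ℕ} (hc : c.2 ≠ 1) :
    Module.finrank K (indecomposables (moduleM I) c) = 0 := by
  rw [indecomposables, gradedPart_moduleM_eq_bot I hc, Submodule.map_bot, finrank_bot]

/-- The second difference of `max (2(i+1) - r) 0`. The halves `r / 2` and `(r + 1) / 2` treat both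
parities at once: `k, k` for `r = 2k` and `k, k + 1` for `r = 2k + 1`. -/
theorem IsGeneric.finrank_indecomposables {X : Finset (ℙ K (Fin 2 → K) × ℙ K (Fin 2 → K))}
    (hX : IsGeneric X) {r : ℕ} (hr : X.card = r) (i : ℕ) :
    Module.finrank K (indecomposables (moduleM (pointsIdeal X)) (i, 1)) =
      (if r / 2 = i then 1 else 0) + (if (r + 1) / 2 = i then 1 else 0) := by
  have hV : ∀ i, Module.finrank K (idealForms (pointsIdeal X) (i, 1)) + min ((i + 1) * 2) r =
      (i + 1) * 2 := by
    intro i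
    have := finrank_idealForms_add_hilbertFunction X i 1
    rwa [hX, hr] at this
  have hq := BiProj.finrank_indecomposables (moduleM (pointsIdeal X)) (i, 1)
  rw [gradedPart_moduleM] at hq
  -- The cases 0 and 1 are the second difference with the convention `v_{-1} = v_{-2} = 0`.
  obtain rfl | rfl | ⟨i, rfl⟩ : i = 0 ∨ i = 1 ∨ ∃ j, i = j + 2 := by
    rcases i with _ | _ | i
    exacts [.inl rfl, .inr (.inl rfl), .inr (.inr ⟨i, rfl⟩)]
  · have h0 := hV 0
    have h1 : Module.finrank K (decomposables (moduleM (pointsIdeal X)) (0, 1)) = 0 := by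
      rw [decomposables_zero, finrank_bot]
    split_ifs <;> omega
  · have h0 := hV 0
    have h1 := hV 1
    have h2 := finrank_decomposables_one (I := pointsIdeal X)
    split_ifs <;> omega
  · have h0 := hV i
    have h1 := hV (i + 1)
    have h2 := hV (i + 2)
    have h3 := finrank_decomposables_add_two
      (fun h hh => mem_pointsIdeal_of_X_mul_mem X (h := h) hh) i
    split_ifs <;> omega

theorem IsGeneric.hasMinimalGeneratorsInBidegrees
    {X : Finset (ℙ K (Fin 2 → K) × ℙ K (Fin 2 → K))} (hX : IsGeneric X) {a b : ℕ}
    (ha : X.card / 2 = a) (hb : (X.card + 1) / 2 = b) :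
    HasMinimalGeneratorsInBidegrees (moduleM (pointsIdeal X)) ![(a, 1), (b, 1)] := by
  refine hasMinimalGeneratorsInBidegrees_of_finrank (moduleM_le_iSup_gradedPart _) _ ?_
  rintro ⟨i, j⟩
  rw [Fintype.card_subtype, Finset.card_filter, Fin.sum_univ_two]
  by_cases hj : j = 1
  · subst hj
    rw [hX.finrank_indecomposables rfl, ha, hb]
    simp
  · rw [finrank_indecomposables_eq_zero _ hj]
    simp [Ne.symm hj]

end BiProj
end

theorem proposition3p1 {K : Type u} [Field K] [IsAlgClosed K] [CharZero K]
    (X : Finset (ℙ K (Fin 2 → K) × ℙ K (Fin 2 → K))) (hX : BiProj.IsGeneric X) (k : ℕ) :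
    (X.card = 2 * k →
      BiProj.HasMinimalGeneratorsInBidegrees (BiProj.moduleM (BiProj.pointsIdeal X))
        ![(k, 1), (k, 1)]) ∧
    (X.card = 2 * k + 1 →
      BiProj.HasMinimalGeneratorsInBidegrees (BiProj.moduleM (BiProj.pointsIdeal X))
        ![(k, 1), (k + 1, 1)]) :=
  ⟨fun h => hX.hasMinimalGeneratorsInBidegrees (by omega) (by omega),
    fun h => hX.hasMinimalGeneratorsInBidegrees (by omega) (by omega)⟩
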